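/- **Corollary 5.2.** Let $K$ be a non-Archimedean ordered field which is maximal ordered (every ordered algebraic extension of $K$ coincides with $K$), Cauchy complete for its order topology, and such that $0$ has a countable basis of neighbourhoods. Let $L\subset K$ be a subfield with which $K$ is non-comparable, i.e. some $x\in K$ is larger than every element of $L$ (for instance $L=\mathbb{Q}$). Put $$A=\{x\in K : |x|\le a \text{ for some positive } a\in L\},\qquad M=\{x\in K : |x|<a \text{ for all positive } a\in L\},$$ the ring of the elements that are not infinitely large with respect to $L$ and its ideal consisting of $0$ and the infinitely small elements. Give $A$ the subspace topology and $A/M$ the quotient topology. For a topological ring $R$ let $R\{X\}$ be the ring of restricted power series over $R$, i.e. those whose coefficients converge to $0$; two restricted series are coprime if they generate the unit ideal of $R\{X\}$. Then $(A,M)$ satisfies Hensel's Lemma for restricted power series: if $S\in A\{X\}$ and the image $\bar S$ of $S$ over $A/M$ is a product $\bar S=\bar P\,\bar T$ of a monic polynomial $\bar P\in (A/M)[X]$ and a restricted series $\bar T\in (A/M)\{X\}$ that are coprime in $(A/M)\{X\}$, then there are a monic polynomial $P\in A[X]$ lifting $\bar P$ and a restricted series $T\in A\{X\}$ lifting $\bar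 T$ such that $S=PT$; moreover $P$ and $T$ are uniquely determined by these properties and are coprime in $A\{X\}$. No element of $M$ is assumed to be topologically nilpotent (this holds even when $M$ contains no topologically nilpotent element other than $0$). -/

import Mathlib

/-- An ordered field `K` is *maximal ordered* if every ordered algebraic extension of `K` coincides
with `K`. (An algebraic extension of an infinite field has the cardinality of that field, so it is
enough to let the extensions range over the universe of `K`.) -/
def IsMaximalOrdered.{u} (K : Type u) [Field K] [LinearOrder K] : Prop :=
  ∀ (E : Type u) [Field E] [LinearOrder E] [IsStrictOrderedRing E] [Algebra K E],
    StrictMono (algebraMap K E) → Algebra.IsAlgebraic K E → Function.Surjective (algebraMap K E)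

section OrderedField

variable {K : Type*} [Field K] [LinearOrder K]

/-- `K` is *non-comparable* with the subfield `L` if some element of `K` is larger than every
element of `L`. -/
def IsNonComparable (L : Subfield K) : Prop :=
  ∃ x : K, ∀ a ∈ L, a < x

/-- `x` is *infinitely large* with respect to `L`: `|x| > a` for all positive `a ∈ L`. -/
def IsInfinitelyLarge (L : Subfield K) (x : K) : Prop :=
  ∀ a ∈ L, 0 < a → a < |x|

/-- `x` is zero or *infinitely small* with respect to `L`: `|x| < a` for all positive `a ∈ L`. -/
def IsInfinitelySmall (L : Subfield K) (x : K) : Prop :=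
  ∀ a ∈ L, 0 < a → |x| < a

theorem not_isInfinitelyLarge_iff (L : Subfield K) (x : K) :
    ¬ IsInfinitelyLarge L x ↔ ∃ a ∈ L, 0 < a ∧ |x| ≤ a := by
  simp [IsInfinitelyLarge]

variable [IsStrictOrderedRing K]

/-- The ring `A_L` of the elements of `K` that are not infinitely large with respect to `L`. It
carries the subspace topology and uniformity whenever `K` is a topological or uniform space. -/
def nonInfinitelyLarge (L : Subfield K) : Subring K where
  carrier := {x | ¬ IsInfinitelyLarge L x}
  mul_mem' := by
    intro x y hx hy
    simp only [Set.mem_ofPred_eq, not_isInfinitelyLarge_iff] at hx hy ⊢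
    obtain ⟨a, ha, ha0, hxa⟩ := hx
    obtain ⟨b, hb, hb0, hyb⟩ := hy
    refine ⟨a * b, L.mul_mem ha hb, mul_pos ha0 hb0, ?_⟩
    rw [abs_mul]
    exact mul_le_mul hxa hyb (abs_nonneg y) ha0.le
  one_mem' := by
    simp only [Set.mem_ofPred_eq, not_isInfinitelyLarge_iff]
    exact ⟨1, L.one_mem, one_pos, by simp⟩
  add_mem' := by
    intro x y hx hy
    simp only [Set.mem_ofPred_eq, not_isInfinitelyLarge_iff] at hx hy ⊢
    obtain ⟨a, ha, ha0, hxa⟩ := hx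
    obtain ⟨b, hb, hb0, hyb⟩ := hy
    exact ⟨a + b, L.add_mem ha hb, add_pos ha0 hb0, (abs_add_le x y).trans (add_le_add hxa hyb)⟩
  zero_mem' := by
    simp only [Set.mem_ofPred_eq, not_isInfinitelyLarge_iff]
    exact ⟨1, L.one_mem, one_pos, by simp⟩
  neg_mem' := by
    intro x hx
    simpa only [Set.mem_ofPred_eq, not_isInfinitelyLarge_iff, abs_neg] using hx

/-- The ideal `M_L` of `A_L` consisting of `0` and the infinitely small elements with respect
to `L`. -/
def infinitelySmallIdeal (L : Subfield K) : Ideal (nonInfinitelyLarge L) where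
  carrier := {x | IsInfinitelySmall L (x : K)}
  add_mem' := by
    intro x y hx hy a ha ha0
    have h2 : a / 2 ∈ L := L.div_mem ha (ofNat_mem L 2)
    have hx' := hx _ h2 (half_pos ha0)
    have hy' := hy _ h2 (half_pos ha0)
    calc |((x + y : nonInfinitelyLarge L) : K)| ≤ |(x : K)| + |(y : K)| := abs_add_le _ _
      _ < a / 2 + a / 2 := add_lt_add hx' hy'
      _ = a := add_halves a
  zero_mem' := by
    intro a _ ha0
    simpa using ha0
  smul_mem' := by
    intro c x hx a ha ha0
    obtain ⟨b, hb, hb0, hcb⟩ := (not_isInfinitelyLarge_iff L (c : K)).1 c.2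
    have hx' := hx _ (L.div_mem ha hb) (div_pos ha0 hb0)
    calc |((c • x : nonInfinitelyLarge L) : K)| = |(c : K)| * |(x : K)| := by
          simp [abs_mul]
      _ ≤ b * |(x : K)| := mul_le_mul_of_nonneg_right hcb (abs_nonneg _)
      _ < b * (a / b) := mul_lt_mul_of_pos_left hx' hb0
      _ = a := mul_div_cancel₀ a hb0.ne'

end OrderedField

section Restricted

/-- A power series over a topological ring is *restricted* if its coefficients converge to `0`. The
restricted series over `R` form the ring denoted by `R{X}`. -/
def IsRestrictedSeries {R : Type*} [CommRing R] [TopologicalSpace R] (S : PowerSeries R) : Prop :=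
  Filter.Tendsto (fun n : ℕ => PowerSeries.coeff n S) Filter.atTop (nhds 0)

/-- Two restricted series are *coprime* if they generate the unit ideal of `R{X}`. -/
def AreCoprimeRestricted {R : Type*} [CommRing R] [TopologicalSpace R]
    (F G : PowerSeries R) : Prop :=
  ∃ U V : PowerSeries R, IsRestrictedSeries U ∧ IsRestrictedSeries V ∧ U * F + V * G = 1

/-- `S = P * T` is a factorization of `S` into a monic polynomial `P` that lifts `P'` and a
restricted series `T` that lifts `T'`. -/
structure IsLiftedFactorization {A : Type*} [CommRing A] [TopologicalSpace A] (M : Ideal A)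
    (S : PowerSeries A) (P' : Polynomial (A ⧸ M)) (T' : PowerSeries (A ⧸ M))
    (P : Polynomial A) (T : PowerSeries A) : Prop where
  monic : P.Monic
  restricted : IsRestrictedSeries T
  map_left : P.map (Ideal.Quotient.mk M) = P'
  map_right : T.map (Ideal.Quotient.mk M) = T'
  eq_mul : S = (P : PowerSeries A) * T

/-- The pair `(A, M)` satisfies *Hensel's Lemma for restricted power series*. Here `A ⧸ M` carries
the quotient topology. If the image over `A ⧸ M` of a restricted series `S` over `A` is the product
of a monic polynomial `P'` and a restricted series `T'` which are coprime, then `S` has a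
factorization lifting this one, its factors are coprime, and it is the only one. -/
def SatisfiesHenselRestricted (A : Type*) [CommRing A] [TopologicalSpace A] (M : Ideal A) : Prop :=
  ∀ (S : PowerSeries A) (P' : Polynomial (A ⧸ M)) (T' : PowerSeries (A ⧸ M)),
    IsRestrictedSeries S → P'.Monic → IsRestrictedSeries T' →
    AreCoprimeRestricted (P' : PowerSeries (A ⧸ M)) T' →
    S.map (Ideal.Quotient.mk M) = (P' : PowerSeries (A ⧸ M)) * T' →
    ∃ (P : Polynomial A) (T : PowerSeries A),
      IsLiftedFactorization M S P' T' P T ∧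
      AreCoprimeRestricted (P : PowerSeries A) T ∧
      ∀ (Q : Polynomial A) (W : PowerSeries A),
        IsLiftedFactorization M S P' T' Q W → Q = P ∧ W = T

end Restricted

/-! The argument has an algebraic half and a topological half, joined in
`SatisfiesHenselRestricted.of_liftsCoprimeFactorizations`.

Algebra: a maximal ordered field is real closed (`IsMaximalOrdered.isRealClosed`), so polynomials
over `K` split into linear factors and quadratic factors without roots
(`IsRealClosed.exists_dvd_of_natDegree_pos`). Each such factor can be rescaled to have coefficients
in `A` and to reduce modulo `M` either to `1` or to a power of a prime polynomial
(`exists_mul_eq_of_natDegree_pos`). A coprime factorization over the field `A ⧸ M` is therefore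
lifted by sorting these factors. No successive approximation takes place, which is why topological
nilpotence plays no role.

Topology: non-comparability makes the topology of `A` linear, with the nonzero principal ideals as a
basis at `0`, and makes `M` open. A restricted series is thus a polynomial modulo each open ideal,
and `A ⧸ M` is discrete. Factor the truncations of `S` over `A`. Their monic factors stabilise
modulo every open ideal, because coprimality lifts along `M` by Nakayama and coprime monic factors
are unique (`Polynomial.map_mk_eq_of_map_mul_eq`). Completeness gives the limit `P`, and division of
`S` by `P` gives `T`. -/

open Polynomial

/-! ### Extending orderings to field extensions (Artin–Schreier). -/

section Orderability

variable {K E : Type*} [Field K] [LinearOrder K] [IsStrictOrderedRing K] [Field E] [Algebra K E]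

/-- The multiplicative monoid of the squares of `E` scaled by non-negative elements of `K`. -/
def scaledSquares (K E : Type*) [Field K] [LinearOrder K] [IsStrictOrderedRing K] [Field E]
    [Algebra K E] : Submonoid E where
  carrier := {x | ∃ a : K, 0 ≤ a ∧ ∃ e : E, x = algebraMap K E a * e ^ 2}
  mul_mem' := by
    rintro _ _ ⟨a, ha, e, rfl⟩ ⟨b, hb, f, rfl⟩
    exact ⟨a * b, mul_nonneg ha hb, e * f, by rw [map_mul]; ring⟩
  one_mem' := ⟨1, zero_le_one, 1, by simp⟩

/-- The set `P - aP` is closed under sums and products and contains the squares. If it contained `-1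
= x - ya`, then `a = (1 + x) / y` would lie in `P`. So when `a ∉ P` it is a preordering, and
maximality puts `-a` in `P`. -/
theorem RingPreordering.mem_or_neg_mem_of_isMax {P : RingPreordering E}
    (hP : ∀ Q : RingPreordering E, P ≤ Q → Q ≤ P) (a : E) : a ∈ P ∨ -a ∈ P := by
  by_contra! h
  obtain ⟨ha, hb⟩ := h
  let Q : RingPreordering E := RingPreordering.mk' {z | ∃ x ∈ P, ∃ y ∈ P, z = x + y * -a}
    (by
      rintro _ _ ⟨x, hx, y, hy, rfl⟩ ⟨x', hx', y', hy', rfl⟩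
      exact ⟨x + x', add_mem hx hx', y + y', add_mem hy hy', by ring⟩)
    (by
      rintro _ _ ⟨x, hx, y, hy, rfl⟩ ⟨x', hx', y', hy', rfl⟩
      exact ⟨x * x' + y * y' * (a * a),
        add_mem (mul_mem hx hx') (mul_mem (mul_mem hy hy') (P.mul_self_mem a)),
        x * y' + y * x', add_mem (mul_mem hx hy') (mul_mem hy hx'), by ring⟩)
    (fun x => ⟨x * x, P.mul_self_mem x, 0, zero_mem P, by ring⟩)
    (by
      rintro ⟨x, hx, y, hy, h⟩
      have hy0 : y ≠ 0 := by
        rintro rfl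
        rw [zero_mul, add_zero] at h
        exact P.neg_one_notMem (h ▸ hx)
      have : a = (1 + x) * y⁻¹ := by
        field_simp
        linear_combination h
      exact ha (this ▸ mul_mem (add_mem (one_mem P) hx) (RingPreordering.inv_mem hy)))
  have hPQ : P ≤ Q := fun x hx => ⟨x, hx, 0, zero_mem P, by ring⟩
  exact hb (hP Q hPQ ⟨0, zero_mem P, 1, one_mem P, by ring⟩)

theorem RingPreordering.exists_isMax_ge (P : RingPreordering E) :
    ∃ Q : RingPreordering E, P ≤ Q ∧ ∀ R : RingPreordering E, Q ≤ R → R ≤ Q := by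
  obtain ⟨Q, hPQ, hQ⟩ := zorn_le_nonempty_Ici₀ P (fun c _ hc x hx => by
    have hdir := hc.directedOn
    refine ⟨RingPreordering.mk' {z | ∃ R ∈ c, z ∈ R} ?_ ?_
      (fun z => ⟨x, hx, x.mul_self_mem z⟩) ?_, fun R hR z hz => ⟨R, hR, hz⟩⟩
    · rintro y z ⟨R, hR, hy⟩ ⟨R', hR', hz⟩
      obtain ⟨U, hU, h1, h2⟩ := hdir R hR R' hR'
      exact ⟨U, hU, add_mem (h1 hy) (h2 hz)⟩
    · rintro y z ⟨R, hR, hy⟩ ⟨R', hR', hz⟩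
      obtain ⟨U, hU, h1, h2⟩ := hdir R hR R' hR'
      exact ⟨U, hU, mul_mem (h1 hy) (h2 hz)⟩
    · rintro ⟨R, hR, h⟩
      exact R.neg_one_notMem h) P le_rfl
  exact ⟨Q, hPQ, fun R hR => hQ hR⟩

/-- Sums of scaled squares form a preordering, and a maximal one above it is the positive cone of a
linear order. Scaling by non-negative elements of `K` is what makes this order extend that of `K`.
-/
theorem exists_linearOrder_of_neg_one_notMem
    (h : (-1 : E) ∉ AddSubmonoid.closure (scaledSquares K E : Set E)) :
    ∃ _ : LinearOrder E, IsStrictOrderedRing E ∧ StrictMono (algebraMap K E) := by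
  let P : RingPreordering E :=
    { (scaledSquares K E).subsemiringClosure with
      mem_of_isSquare' := by
        rintro _ ⟨e, rfl⟩
        exact AddSubmonoid.subset_closure ⟨1, zero_le_one, e, by rw [map_one]; ring⟩
      neg_one_notMem' := h }
  obtain ⟨Q, hPQ, hQ⟩ := P.exists_isMax_ge
  have htot := RingPreordering.mem_or_neg_mem_of_isMax hQ
  let C : RingCone E :=
    { Q.toSubsemiring with
      eq_zero_of_mem_of_neg_mem' := fun h1 h2 => RingPreordering.eq_zero_of_mem_of_neg_mem h1 h2 }
  have : HasMemOrNegMem C := ⟨htot⟩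
  classical
  let o : LinearOrder E := LinearOrder.mkOfAddGroupCone C
  have : IsOrderedRing E := IsOrderedRing.mkOfCone C
  have : IsStrictOrderedRing E := IsOrderedRing.toIsStrictOrderedRing E
  refine ⟨o, inferInstance, ?_⟩
  have hmono : Monotone (algebraMap K E) := by
    intro a b hab
    change _ ∈ C
    rw [← map_sub]
    exact hPQ (AddSubmonoid.subset_closure ⟨b - a, sub_nonneg.2 hab, 1, by simp⟩)
  exact hmono.strictMono_of_injective (algebraMap K E).injective

end Orderability

theorem IsMaximalOrdered.surjective_algebraMap.{u} {K E : Type u} [Field K] [LinearOrder K]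
    [IsStrictOrderedRing K] (hK : IsMaximalOrdered K) [Field E] [Algebra K E]
    [Algebra.IsAlgebraic K E] (h : (-1 : E) ∉ AddSubmonoid.closure (scaledSquares K E : Set E)) :
    Function.Surjective (algebraMap K E) := by
  obtain ⟨o, h1, h2⟩ := exists_linearOrder_of_neg_one_notMem h
  exact hK E h2 inferInstance

/-! ### Maximal ordered fields are real closed. -/

section RealRoots

universe u

variable {K : Type u} [Field K] [LinearOrder K] [IsStrictOrderedRing K]

/-- Represent every squared element by its remainder modulo `f`. The degree bound is what drives the
descent in `IsMaximalOrdered.exists_isRoot_of_eval_mul_eval_neg`. -/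
theorem AdjoinRoot.exists_nonneg_of_mem_closure_scaledSquares {f : K[X]} (hf : 0 < f.natDegree)
    {t : AdjoinRoot f} [Fact (Irreducible f)]
    (ht : t ∈ AddSubmonoid.closure (scaledSquares K (AdjoinRoot f) : Set (AdjoinRoot f))) :
    ∃ p : K[X], AdjoinRoot.mk f p = t ∧ p.natDegree ≤ 2 * (f.natDegree - 1) ∧
      ∀ x, 0 ≤ p.eval x := by
  induction ht using AddSubmonoid.closure_induction with
  | mem t ht =>
    obtain ⟨a, ha, e, rfl⟩ := ht
    obtain ⟨g, rfl⟩ := AdjoinRoot.mk_surjective e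
    refine ⟨C a * (g % f) ^ 2, ?_, ?_, fun x => ?_⟩
    · have h : AdjoinRoot.mk f (g % f) = AdjoinRoot.mk f g := by
        rw [eq_comm, AdjoinRoot.mk_eq_mk]
        exact ⟨g / f, by linear_combination (EuclideanDomain.div_add_mod g f).symm⟩
      rw [map_mul, map_pow, h, AdjoinRoot.mk_C, AdjoinRoot.algebraMap_eq]
    · refine (natDegree_C_mul_le _ _).trans (natDegree_pow_le.trans ?_)
      have := natDegree_mod_lt g hf.ne'
      gcongr
      omega
    · rw [eval_mul, eval_C, eval_pow]
      positivity
  | zero => exact ⟨0, by simp, by simp, by simp⟩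
  | add s t _ _ hs ht =>
    obtain ⟨p, rfl, hp, hp'⟩ := hs
    obtain ⟨q, rfl, hq, hq'⟩ := ht
    exact ⟨p + q, map_add _ _ _, natDegree_add_le_of_degree_le hp hq, fun x => by
      rw [eval_add]; exact add_nonneg (hp' x) (hq' x)⟩

/-- In a maximal ordered field, a polynomial that changes sign has a root. -/
theorem IsMaximalOrdered.exists_isRoot_of_eval_mul_eval_neg (hK : IsMaximalOrdered K) {f : K[X]}
    {a b : K} (hab : f.eval a * f.eval b < 0) : ∃ c, f.IsRoot c := by
  induction hn : f.natDegree using Nat.strong_induction_on generalizing f with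
  | _ n ih =>
  subst hn
  have hf0 : f ≠ 0 := by rintro rfl; simp at hab
  have hfd : 0 < f.natDegree := by
    by_contra! h
    rw [eq_C_of_natDegree_le_zero h, eval_C, eval_C] at hab
    exact (mul_self_nonneg _).not_gt hab
  have hfu : ¬ IsUnit f := fun h => hfd.ne' (natDegree_eq_zero_of_isUnit h)
  by_cases hirr : Irreducible f
  · have : Fact (Irreducible f) := ⟨hirr⟩
    have := (AdjoinRoot.powerBasis hf0).finite
    by_cases hneg : (-1 : AdjoinRoot f) ∈
        AddSubmonoid.closure (scaledSquares K (AdjoinRoot f) : Set (AdjoinRoot f))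
    · obtain ⟨p, hp, hpd, hp0⟩ := AdjoinRoot.exists_nonneg_of_mem_closure_scaledSquares hfd hneg
      have hdvd : f ∣ 1 + p := by
        rw [← AdjoinRoot.mk_eq_zero, map_add, map_one, hp]
        ring
      obtain ⟨h, hh⟩ := hdvd
      have hpos : ∀ x, 0 < f.eval x * h.eval x := fun x => by
        rw [← eval_mul, ← hh, eval_add, eval_one]
        linarith [hp0 x]
      have hh0 : h ≠ 0 := by
        rintro rfl
        simpa using hpos 0
      -- From `1 + p = f * h` this gives `deg h ≤ deg f - 2`. Since `f * h` is positive everywhere,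
      -- `h` changes sign together with `f`, so by induction it has a root, where `f * h` would
      -- vanish.
      have hdeg : (1 + p).natDegree ≤ 2 * (f.natDegree - 1) :=
        natDegree_add_le_of_degree_le (by simp) hpd
      rw [hh, natDegree_mul hf0 hh0] at hdeg
      obtain ⟨c, hc⟩ := ih h.natDegree (by omega) (f := h)
        (by nlinarith [mul_pos (hpos a) (hpos b)]) rfl
      have := hpos c
      rw [hc.eq_zero, mul_zero] at this
      exact absurd this (lt_irrefl _)
    · obtain ⟨c, hc⟩ := hK.surjective_algebraMap hneg (AdjoinRoot.root f)
      refine ⟨c, ?_⟩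
      have h := AdjoinRoot.eval₂_root f
      rw [← hc, AdjoinRoot.algebraMap_eq, eval₂_at_apply] at h
      exact (AdjoinRoot.of f).injective (h.trans (map_zero _).symm)
  · obtain ⟨g, h, hg, hh, rfl⟩ : ∃ g h, ¬ IsUnit g ∧ ¬ IsUnit h ∧ f = g * h := by
      rw [irreducible_iff] at hirr
      push Not at hirr
      obtain ⟨g, h, e, hg, hh⟩ := hirr hfu
      exact ⟨g, h, hg, hh, e⟩
    have hg0 := left_ne_zero_of_mul hf0
    have hh0 := right_ne_zero_of_mul hf0
    rw [natDegree_mul hg0 hh0] at ih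
    have hgd : 0 < g.natDegree := natDegree_pos_iff_degree_pos.2 (degree_pos_of_ne_zero_of_nonunit hg0 hg)
    have hhd : 0 < h.natDegree := natDegree_pos_iff_degree_pos.2 (degree_pos_of_ne_zero_of_nonunit hh0 hh)
    rw [eval_mul, eval_mul, mul_mul_mul_comm] at hab
    rcases mul_neg_iff.1 hab with ⟨-, h'⟩ | ⟨h', -⟩
    · obtain ⟨c, hc⟩ := ih _ (by omega) h' rfl
      exact ⟨c, root_mul_left_of_isRoot _ hc⟩
    · obtain ⟨c, hc⟩ := ih _ (by omega) h' rfl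
      exact ⟨c, root_mul_right_of_isRoot _ hc⟩

/-- Induction along `f = X * f.divX + f.coeff 0`. A uniform bound `δ`, rather than mere positivity,
lets the first term outweigh the constant one. -/
theorem Polynomial.exists_forall_le_eval_of_leadingCoeff_pos {f : K[X]} (hf : 0 < f.leadingCoeff) :
    ∃ δ > 0, ∃ B, ∀ x ≥ B, δ ≤ f.eval x := by
  induction hn : f.natDegree generalizing f with
  | zero =>
    rw [eq_C_of_natDegree_eq_zero hn] at hf ⊢
    rw [leadingCoeff_C] at hf
    exact ⟨_, hf, 0, fun x _ => by rw [eval_C]⟩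
  | succ n ih =>
    have hlead : f.divX.leadingCoeff = f.leadingCoeff := by
      rw [leadingCoeff, leadingCoeff, natDegree_divX_eq_natDegree_tsub_one, hn, coeff_divX]
      rfl
    obtain ⟨δ, hδ, B, hB⟩ := ih (f := f.divX) (hlead ▸ hf)
      (by rw [natDegree_divX_eq_natDegree_tsub_one, hn]; rfl)
    refine ⟨1, one_pos, max B ((|f.coeff 0| + 1) / δ), fun x hx => ?_⟩
    have h1 := hB x ((le_max_left _ _).trans hx)
    have h2 := (le_max_right _ _).trans hx
    have hx0 : 0 ≤ x := le_trans (by positivity) h2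
    rw [div_le_iff₀ hδ] at h2
    rw [← divX_mul_X_add f, eval_add, eval_mul, eval_X, eval_C]
    have h3 := mul_le_mul_of_nonneg_right h1 hx0
    have h4 := neg_abs_le (f.coeff 0)
    linarith

theorem IsMaximalOrdered.isRealClosed (hK : IsMaximalOrdered K) : IsRealClosed K := by
  refine .of_linearOrderedField (fun {a} ha => ?_) fun {f} hf => ?_
  · rcases ha.eq_or_lt with rfl | ha
    · exact IsSquare.zero
    · obtain ⟨c, hc⟩ := hK.exists_isRoot_of_eval_mul_eval_neg (f := X ^ 2 - C a) (a := 0)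
        (b := a + 1) (by simp; exact mul_pos ha (by nlinarith))
      refine ⟨c, ?_⟩
      simp only [IsRoot, eval_sub, eval_pow, eval_X, eval_C] at hc
      linear_combination -hc
  · wlog hpos : 0 < f.leadingCoeff generalizing f
    · have hf0 : f.leadingCoeff ≠ 0 := by
        rw [Ne, leadingCoeff_eq_zero]
        rintro rfl
        simp at hf
      obtain ⟨c, hc⟩ := this (f := -f) (by rwa [natDegree_neg]) (by
        rw [leadingCoeff_neg]
        exact neg_pos.2 (lt_of_le_of_ne (not_lt.1 hpos) hf0))
      exact ⟨c, by simpa using hc⟩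
    obtain ⟨δ, hδ, B, hB⟩ := exists_forall_le_eval_of_leadingCoeff_pos hpos
    obtain ⟨δ', hδ', B', hB'⟩ := exists_forall_le_eval_of_leadingCoeff_pos (f := -f.comp (-X)) (by
      rw [leadingCoeff_neg, leadingCoeff_comp (by simp)]
      simpa [hf.neg_one_pow] using hpos)
    refine hK.exists_isRoot_of_eval_mul_eval_neg (a := B) (b := -B') ?_
    have h1 := hB B le_rfl
    have h2 := hB' B' le_rfl
    simp only [eval_neg, eval_comp, eval_X] at h2
    exact mul_neg_of_pos_of_neg (by linarith) (by linarith)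

end RealRoots

/-! ### The fundamental theorem of algebra over a real closed field. -/

section FundamentalTheorem

open IntermediateField

universe u

variable {K N : Type u} [Field K] [IsRealClosed K] [Field N] [Algebra K N]

theorem IsRealClosed.mem_range_algebraMap_of_odd_finrank {F : Type*} [Field F] [Algebra K F]
    (hF : Odd (Module.finrank K F)) (x : F) : x ∈ (algebraMap K F).range := by
  have : FiniteDimensional K F := Module.finite_of_finrank_pos hF.pos
  have hx : IsIntegral K x := .of_finite K x
  obtain ⟨c, hc⟩ := IsRealClosed.exists_isRoot_of_odd_natDegree
    (hF.of_dvd_nat (minpoly.degree_dvd hx))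
  exact minpoly.mem_range_of_degree_eq_one K x
    (degree_eq_one_of_irreducible_of_root (minpoly.irreducible hx) hc)

/-- The fixed field of a Sylow 2-subgroup has odd degree over `K`, hence equals `K`; so the whole
Galois group is a 2-group. -/
theorem IsRealClosed.finrank_eq_two_pow [FiniteDimensional K N] [IsGalois K N] :
    ∃ k, Module.finrank K N = 2 ^ k := by
  let P : Sylow 2 Gal(N/K) := default
  have hodd : Odd (Module.finrank K (fixedField (P : Subgroup Gal(N/K)))) := by
    rw [finrank_eq_fixingSubgroup_index, fixingSubgroup_fixedField, ← Nat.not_even_iff_odd,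
      even_iff_two_dvd]
    exact P.not_dvd_index
  have hbot : fixedField (P : Subgroup Gal(N/K)) = ⊥ := by
    rw [eq_bot_iff]
    intro x hx
    obtain ⟨a, ha⟩ := mem_range_algebraMap_of_odd_finrank hodd (⟨x, hx⟩ : fixedField _)
    exact mem_bot.2 ⟨a, congrArg Subtype.val ha⟩
  have hP : (P : Subgroup Gal(N/K)) = ⊤ := by
    rw [← fixingSubgroup_fixedField (P : Subgroup Gal(N/K)), hbot, fixingSubgroup_bot]
  obtain ⟨k, hk⟩ := P.isPGroup'.exists_card_eq
  exact ⟨k, by rw [← IsGalois.card_aut_eq_finrank, ← hk, hP, Subgroup.card_top]⟩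

end FundamentalTheorem

section OrderedFundamentalTheorem

open IntermediateField

universe u

variable {K N : Type u} [Field K] [LinearOrder K] [IsStrictOrderedRing K] [Field N] [Algebra K N]

theorem IntermediateField.exists_add_mul_of_mem_adjoin {i : N} (hi : i ^ 2 = -1) {z : N}
    (hz : z ∈ K⟮i⟯) : ∃ a b : K, z = algebraMap K N a + algebraMap K N b * i := by
  induction hz using adjoin_induction with
  | mem x hx =>
    rw [Set.mem_singleton_iff.1 hx]
    exact ⟨0, 1, by simp⟩
  | algebraMap a => exact ⟨a, 0, by simp⟩
  | add x y _ _ hx hy =>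
    obtain ⟨a, b, rfl⟩ := hx
    obtain ⟨c, d, rfl⟩ := hy
    exact ⟨a + c, b + d, by simp only [map_add]; ring⟩
  | mul x y _ _ hx hy =>
    obtain ⟨a, b, rfl⟩ := hx
    obtain ⟨c, d, rfl⟩ := hy
    refine ⟨a * c - b * d, a * d + b * c, ?_⟩
    simp only [map_add, map_sub, map_mul]
    linear_combination algebraMap K N b * algebraMap K N d * hi
  | inv x _ hx =>
    obtain ⟨a, b, rfl⟩ := hx
    by_cases h : a ^ 2 + b ^ 2 = 0
    · have ha : a = 0 := by nlinarith [sq_nonneg a, sq_nonneg b]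
      have hb : b = 0 := by nlinarith [sq_nonneg a, sq_nonneg b]
      exact ⟨0, 0, by simp [ha, hb]⟩
    · refine ⟨a / (a ^ 2 + b ^ 2), -b / (a ^ 2 + b ^ 2), ?_⟩
      have h' : algebraMap K N a ^ 2 + algebraMap K N b ^ 2 ≠ 0 := by
        rw [← map_pow, ← map_pow, ← map_add]
        exact (_root_.map_ne_zero _).2 h
      apply inv_eq_of_mul_eq_one_left
      simp only [map_div₀, map_add, map_pow, map_neg]
      field_simp
      linear_combination -algebraMap K N b ^ 2 * hi

variable [IsRealClosed K]

/-- With `r = √(a² + b²)`, the root is `c + di`, where `c² = (r + a) / 2` and `d² = (r - a) / 2`.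
These determine `2cd = b` only up to sign, so `d` may have to be replaced by `-d`. -/
theorem IsRealClosed.exists_sq_eq_of_mem_adjoin {i : N} (hi : i ^ 2 = -1) {z : N}
    (hz : z ∈ K⟮i⟯) : ∃ w ∈ K⟮i⟯, w ^ 2 = z := by
  obtain ⟨a, b, rfl⟩ := exists_add_mul_of_mem_adjoin hi hz
  obtain ⟨r, hr⟩ := IsSquare.of_nonneg (add_nonneg (sq_nonneg a) (sq_nonneg b))
  wlog hr0 : 0 ≤ r generalizing r
  · exact this (-r) (by rw [hr]; ring) (by linarith)
  have har : |a| ≤ r := abs_le_of_sq_le_sq (by nlinarith [sq_nonneg b]) hr0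
  rw [abs_le] at har
  obtain ⟨c, hc⟩ := IsSquare.of_nonneg (x := (r + a) / 2) (by linarith)
  obtain ⟨d, hd⟩ := IsSquare.of_nonneg (x := (r - a) / 2) (by linarith)
  have key : ∀ d : K, d * d = (r - a) / 2 → 2 * c * d = b →
      ∃ w ∈ K⟮i⟯, w ^ 2 = algebraMap K N a + algebraMap K N b * i := by
    intro d hd h
    have hia : ∀ x : K, algebraMap K N x ∈ K⟮i⟯ := fun x => IntermediateField.algebraMap_mem _ x
    refine ⟨algebraMap K N c + algebraMap K N d * i,
      add_mem (hia c) (mul_mem (hia d) (mem_adjoin_simple_self K i)), ?_⟩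
    have h1 : a = c ^ 2 - d ^ 2 := by linear_combination hc + hd
    rw [h1, ← h]
    simp only [map_sub, map_pow, map_mul, map_ofNat]
    linear_combination algebraMap K N d ^ 2 * hi
  have h4 : (2 * c * d) ^ 2 = b ^ 2 := by
    have : (2 * c * d) ^ 2 = 4 * ((c * c) * (d * d)) := by ring
    rw [this, ← hc, ← hd]
    linear_combination -hr
  rcases sq_eq_sq_iff_eq_or_eq_neg.1 h4 with h | h
  · exact key d hd.symm h
  · exact key (-d) (by rw [hd]; ring) (by linear_combination -h)

/-- If the 2-power `[N : K(i)]` were not `1`, a subgroup of index 2 would give a quadratic extension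
of `K(i)`. The quadratic formula excludes this, since `K(i)` is closed under square roots. -/
theorem IsRealClosed.adjoin_eq_top [FiniteDimensional K N] [IsGalois K N] {i : N}
    (hi : i ^ 2 = -1) : K⟮i⟯ = ⊤ := by
  obtain ⟨k, hk⟩ := finrank_eq_two_pow (K := K) (N := N)
  obtain ⟨m, -, hm⟩ := (Nat.dvd_prime_pow Nat.prime_two).1
    (hk ▸ Module.finrank_mul_finrank K K⟮i⟯ N ▸ Dvd.intro_left _ rfl :
      Module.finrank K⟮i⟯ N ∣ 2 ^ k)
  rcases m with _ | m
  · rwa [pow_zero, finrank_eq_one_iff_eq_top] at hm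
  exfalso
  obtain ⟨H, hH⟩ := Sylow.exists_subgroup_card_pow_prime (G := Gal(N/K⟮i⟯)) 2 (n := m)
    (by rw [IsGalois.card_aut_eq_finrank, hm]; exact pow_dvd_pow _ (Nat.le_succ m))
  have hrank : Module.finrank K⟮i⟯ (fixedField H) = 2 := by
    have h := Module.finrank_mul_finrank K⟮i⟯ (fixedField H) N
    rw [finrank_fixedField_eq_card, hH, hm, pow_succ, mul_comm] at h
    exact Nat.eq_of_mul_eq_mul_left (by positivity) h
  have hbot : fixedField H = ⊥ := by
    rw [eq_bot_iff]
    intro x hx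
    let y : fixedField H := ⟨x, hx⟩
    have hy : IsIntegral K⟮i⟯ y := .of_finite _ _
    have hdeg : (minpoly K⟮i⟯ y).natDegree ≤ 2 :=
      Nat.le_of_dvd two_pos (hrank ▸ minpoly.degree_dvd hy)
    have hdeg0 := minpoly.natDegree_pos hy
    have hmonic := minpoly.monic hy
    have haev := minpoly.aeval K⟮i⟯ y
    rcases (by omega : (minpoly K⟮i⟯ y).natDegree = 1 ∨ (minpoly K⟮i⟯ y).natDegree = 2) with h | h
    · obtain ⟨a, ha⟩ := minpoly.mem_range_of_degree_eq_one K⟮i⟯ y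
        ((degree_eq_iff_natDegree_eq_of_pos one_pos).2 h)
      exact mem_bot.2 ⟨a, congrArg Subtype.val ha⟩
    · have hx2 : x ^ 2 + ((minpoly K⟮i⟯ y).coeff 1 : N) * x + ((minpoly K⟮i⟯ y).coeff 0 : N) = 0 := by
        have h2 : (minpoly K⟮i⟯ y).coeff 2 = 1 := by
          have := hmonic.coeff_natDegree
          rwa [h] at this
        rw [aeval_eq_sum_range, h] at haev
        simp only [Finset.sum_range_succ, Finset.sum_range_zero, h2] at haev
        have := congrArg Subtype.val haev
        simp only [pow_zero, pow_one, zero_add, Algebra.smul_def] at this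
        simp at this
        linear_combination this
      generalize (minpoly K⟮i⟯ y).coeff 1 = β at hx2
      generalize (minpoly K⟮i⟯ y).coeff 0 = γ at hx2
      obtain ⟨w, hw, hw2⟩ := exists_sq_eq_of_mem_adjoin hi (β ^ 2 - 4 * γ : K⟮i⟯).2
      have hfac : (2 * x + β - w) * (2 * x + β + w) = 0 := by
        have : w ^ 2 = (β : N) ^ 2 - 4 * γ := hw2
        linear_combination 4 * hx2 - this
      have h2 : (2 : N) ≠ 0 := by
        have : CharZero N := charZero_of_injective_algebraMap (algebraMap K N).injective
        exact two_ne_zero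
      have h2m : (2 : N) ∈ K⟮i⟯ := ofNat_mem _ 2
      have hmem : x ∈ K⟮i⟯ := by
        rcases mul_eq_zero.1 hfac with h | h
        · have : x = (w - β) / 2 := by field_simp; linear_combination h
          rw [this]
          exact div_mem (sub_mem hw β.2) h2m
        · have : x = (-w - β) / 2 := by field_simp; linear_combination h
          rw [this]
          exact div_mem (sub_mem (neg_mem hw) β.2) h2m
      exact mem_bot.2 ⟨⟨x, hmem⟩, rfl⟩
  rw [hbot, IntermediateField.finrank_bot] at hrank
  omega

/-- Every non-constant polynomial over a real closed field has a linear factor or a quadratic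
factor without roots. -/
theorem IsRealClosed.exists_dvd_of_natDegree_pos {f : K[X]} (hf : 0 < f.natDegree) :
    (∃ a, X - C a ∣ f) ∨ ∃ a b, b ≠ 0 ∧ (X - C a) ^ 2 + C (b ^ 2) ∣ f := by
  -- The extra factor puts a square root of `-1` into the splitting field.
  let g : K[X] := f * (X ^ 2 + 1)
  have hf0 : f ≠ 0 := by rintro rfl; simp at hf
  have hX0 : (X ^ 2 + 1 : K[X]).Monic := by monicity!
  let N := g.SplittingField
  have : IsGalois K N := { to_normal := Normal.of_isSplittingField g }
  have hsplit : (g.map (algebraMap K N)).Splits := SplittingField.splits g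
  simp only [g, Polynomial.map_mul] at hsplit
  rw [splits_mul (Polynomial.map_ne_zero hf0) (Polynomial.map_ne_zero hX0.ne_zero)] at hsplit
  obtain ⟨z, hz⟩ := hsplit.1.exists_eval_eq_zero (by
    rw [degree_map]; exact (natDegree_pos_iff_degree_pos.1 hf).ne')
  obtain ⟨i, hi⟩ := hsplit.2.exists_eval_eq_zero (by
    rw [degree_map]
    have : (X ^ 2 + 1 : K[X]).degree = 2 := by compute_degree!
    rw [this]; norm_num)
  have hi : i ^ 2 = -1 := by
    simp at hi
    linear_combination hi
  obtain ⟨a, b, rfl⟩ := exists_add_mul_of_mem_adjoin hi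
    (adjoin_eq_top (K := K) hi ▸ mem_top : z ∈ K⟮i⟯)
  rw [eval_map_algebraMap] at hz
  by_cases hb : b = 0
  · left
    refine ⟨a, dvd_iff_isRoot.2 ((algebraMap K N).injective ?_)⟩
    rw [hb, map_zero, zero_mul, add_zero, aeval_algebraMap_apply] at hz
    rw [coe_aeval_eq_eval] at hz
    rw [hz, map_zero]
  · right
    refine ⟨a, b, hb, ?_⟩
    set p : K[X] := (X - C a) ^ 2 + C (b ^ 2) with hp
    have hpm : p.Monic := by rw [hp]; monicity!
    have hpd : p.natDegree = 2 := by rw [hp]; compute_degree!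
    rw [← modByMonic_eq_zero_iff_dvd hpm]
    have hpz : aeval (algebraMap K N a + algebraMap K N b * i) p = 0 := by
      simp [hp]
      linear_combination algebraMap K N b ^ 2 * hi
    have hrz : aeval (algebraMap K N a + algebraMap K N b * i) (f %ₘ p) = 0 := by
      have := modByMonic_add_div f p
      rw [← this] at hz
      simpa [hpz] using hz
    have hrd : (f %ₘ p).natDegree ≤ 1 := by
      have := natDegree_modByMonic_lt f hpm (by rintro h; rw [h] at hpd; simp at hpd)
      omega
    -- The remainder `uX + v` vanishes at `a + bi`. Squaring `ua + v = -ubi` makes a sum of two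
    -- squares of `K` zero, so `ub = 0`, and `b ≠ 0` kills the remainder.
    obtain ⟨u, v, huv⟩ := exists_eq_X_add_C_of_natDegree_le_one hrd
    rw [huv] at hrz ⊢
    simp at hrz
    have h1 : algebraMap K N (u * a + v) = - algebraMap K N (u * b) * i := by
      simp only [map_add, map_mul]
      linear_combination hrz
    have h2 : (u * a + v) ^ 2 + (u * b) ^ 2 = 0 := by
      apply (algebraMap K N).injective
      rw [map_add, map_pow, map_pow, h1, map_zero]
      linear_combination algebraMap K N (u * b) ^ 2 * hi
    have h3 : u * b = 0 := by nlinarith [sq_nonneg (u * a + v), sq_nonneg (u * b)]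
    have hu : u = 0 := (mul_eq_zero.1 h3).resolve_right hb
    have hv : v = 0 := by simpa [hu] using h2
    simp [hu, hv]

end OrderedFundamentalTheorem

/-! ### Lifting coprime factorizations of polynomials. -/

section PolynomialFactorization

/-- `p` is invertible as a power series over `A`, so the quotient `f / p` already has its
coefficients in `A`; over `K` it is a polynomial. This substitutes for division by a monic
polynomial. -/
theorem Polynomial.dvd_of_map_dvd_map_of_coeff_zero_eq_one {A K : Type*} [CommRing A] [Field K]
    {φ : A →+* K} (hφ : Function.Injective φ) {p f : A[X]} (hp : p.coeff 0 = 1)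
    (h : p.map φ ∣ f.map φ) : p ∣ f := by
  obtain ⟨q, hq⟩ := h
  obtain ⟨u, hu⟩ : IsUnit (p : PowerSeries A) :=
    PowerSeries.isUnit_iff_constantCoeff.2 (by simp [hp])
  let r : PowerSeries A := (↑u⁻¹ : PowerSeries A) * f
  have hr : (p : PowerSeries A) * r = f := by
    rw [← hu, Units.mul_inv_cancel_left]
  have hp0 : (p : PowerSeries A).map φ ≠ 0 := fun h0 => by
    have := congrArg (PowerSeries.coeff 0) h0
    simp [hp] at this
  have hrq : r.map φ = (q : PowerSeries K) := by
    apply mul_left_cancel₀ hp0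
    rw [← map_mul, hr, ← polynomial_map_coe, ← polynomial_map_coe, hq, Polynomial.coe_mul]
  refine ⟨PowerSeries.trunc (q.natDegree + 1) r, Polynomial.map_injective φ hφ ?_⟩
  rw [hq, Polynomial.map_mul, ← PowerSeries.trunc_map, hrq, PowerSeries.trunc_coe_eq_self]
  omega

/-- `(A, M)` lifts coprime factorizations of polynomials over `A ⧸ M`, one of whose factors is
monic. -/
def LiftsCoprimeFactorizations {A : Type*} [CommRing A] (M : Ideal A) : Prop :=
  ∀ (f : A[X]) (g' h' : (A ⧸ M)[X]), g'.Monic → IsCoprime g' h' →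
    f.map (Ideal.Quotient.mk M) = g' * h' →
    ∃ g h : A[X], g.Monic ∧ g.map (Ideal.Quotient.mk M) = g' ∧
      h.map (Ideal.Quotient.mk M) = h' ∧ f = g * h

/-- Split off `p` and induct on the degree. A factor reducing to `1` is absorbed into `h`. A factor
reducing to `π ^ m` divides `g'` or `h'` by coprimality, and joins the lift of that one. -/
theorem LiftsCoprimeFactorizations.of_forall_exists_mul_eq {A : Type*} [CommRing A] {M : Ideal A}
    [M.IsMaximal]
    (H : ∀ f : A[X], 0 < f.natDegree → ∃ p q : A[X], f = p * q ∧ q.natDegree < f.natDegree ∧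
      (p.map (Ideal.Quotient.mk M) = 1 ∨
        p.Monic ∧ ∃ (π : (A ⧸ M)[X]) (m : ℕ), Prime π ∧ p.map (Ideal.Quotient.mk M) = π ^ m)) :
    LiftsCoprimeFactorizations M := by
  let _ : Field (A ⧸ M) := Ideal.Quotient.field M
  intro f
  induction hn : f.natDegree using Nat.strong_induction_on generalizing f with
  | _ n ih =>
  subst hn
  intro g' h' hg' hco hf
  rcases Nat.eq_zero_or_pos f.natDegree with h0 | h0
  · have hg1 : g' = 1 := by
      by_cases hh : h' = 0
      · rw [hh, isCoprime_zero_right] at hco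
        exact hg'.eq_one_of_isUnit hco
      · apply hg'.natDegree_eq_zero.1
        have h1 := natDegree_map_le (f := Ideal.Quotient.mk M) (p := f)
        rw [hf, natDegree_mul hg'.ne_zero hh] at h1
        omega
    exact ⟨1, f, monic_one, by rw [Polynomial.map_one, hg1], by rw [hf, hg1, one_mul],
      (one_mul f).symm⟩
  · obtain ⟨p, q, rfl, hqd, hp⟩ := H f h0
    rw [Polynomial.map_mul] at hf
    rcases hp with hp | ⟨hpm, π, m, hπ, hp⟩
    · rw [hp, one_mul] at hf
      obtain ⟨g, h, hg, hgm, hhm, rfl⟩ := ih _ hqd q rfl g' h' hg' hco hf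
      exact ⟨g, p * h, hg, hgm, by rw [Polynomial.map_mul, hp, hhm, one_mul], by ring⟩
    · rw [hp] at hf
      have hπ0 : π ^ m ≠ 0 := pow_ne_zero m hπ.ne_zero
      have hdvd : π ^ m ∣ g' ∨ π ^ m ∣ h' := by
        have h1 : π ^ m ∣ g' * h' := Dvd.intro _ hf
        by_cases hd : π ∣ g'
        · left
          refine IsCoprime.dvd_of_dvd_mul_right (IsCoprime.pow_left ?_) h1
          refine (hπ.irreducible.coprime_iff_not_dvd).2 fun hd' => ?_
          exact hπ.not_isUnit (hco.isUnit_of_dvd' hd hd')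
        · right
          exact ((hπ.irreducible.coprime_iff_not_dvd).2 hd).pow_left.dvd_of_dvd_mul_left h1
      have hpm' : (π ^ m).Monic := hp ▸ hpm.map _
      rcases hdvd with ⟨g₁, rfl⟩ | ⟨h₁, rfl⟩
      · obtain ⟨g, h, hg, hgm, hhm, rfl⟩ := ih _ hqd q rfl g₁ h' (hpm'.of_mul_monic_left hg')
          hco.of_mul_left_right (mul_left_cancel₀ hπ0 (by rw [hf]; ring))
        exact ⟨p * g, h, hpm.mul hg, by rw [Polynomial.map_mul, hp, hgm], hhm, by ring⟩
      · obtain ⟨g, h, hg, hgm, hhm, rfl⟩ := ih _ hqd q rfl g' h₁ hg'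
          hco.of_mul_right_right (mul_left_cancel₀ hπ0 (by rw [hf]; ring))
        exact ⟨g, p * h, hg, hgm, by rw [Polynomial.map_mul, hp, hhm], by ring⟩

end PolynomialFactorization

/-! ### The convex subring `A` and factorization over it. -/

section ConvexSubring

variable {K : Type*} [Field K] [LinearOrder K] [IsStrictOrderedRing K] {L : Subfield K}

theorem mem_nonInfinitelyLarge {x : K} :
    x ∈ nonInfinitelyLarge L ↔ ∃ a ∈ L, 0 < a ∧ |x| ≤ a :=
  not_isInfinitelyLarge_iff L x

theorem mem_infinitelySmallIdeal {x : nonInfinitelyLarge L} :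
    x ∈ infinitelySmallIdeal L ↔ IsInfinitelySmall L (x : K) := Iff.rfl

theorem IsInfinitelySmall.mono {K : Type*} [Field K] [LinearOrder K] {L : Subfield K} {x y : K}
    (hy : IsInfinitelySmall L y) (h : |x| ≤ |y|) :
    IsInfinitelySmall L x := fun a ha h0 => h.trans_lt (hy a ha h0)

theorem IsInfinitelySmall.of_sq {x : K} (hx : IsInfinitelySmall L (x ^ 2)) :
    IsInfinitelySmall L x := fun a ha h0 => by
  have := hx (a ^ 2) (pow_mem ha 2) (by positivity)
  rw [abs_pow] at this
  exact lt_of_pow_lt_pow_left₀ 2 h0.le this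

theorem nonInfinitelyLarge_mem_of_le {x y : K} (hy : y ∈ nonInfinitelyLarge L) (h : |x| ≤ |y|) :
    x ∈ nonInfinitelyLarge L := by
  rw [mem_nonInfinitelyLarge] at hy ⊢
  obtain ⟨a, ha, h0, hya⟩ := hy
  exact ⟨a, ha, h0, h.trans hya⟩

theorem nonInfinitelyLarge_mem_of_sq {x : K} (hx : x ^ 2 ∈ nonInfinitelyLarge L) :
    x ∈ nonInfinitelyLarge L := by
  rw [mem_nonInfinitelyLarge] at hx ⊢
  obtain ⟨a, ha, h0, hxa⟩ := hx
  refine ⟨a + 1, add_mem ha (one_mem L), by positivity, ?_⟩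
  rw [abs_pow] at hxa
  nlinarith [abs_nonneg x]

theorem IsInfinitelySmall.mem {x : K} (hx : IsInfinitelySmall L x) : x ∈ nonInfinitelyLarge L :=
  mem_nonInfinitelyLarge.2 ⟨1, one_mem L, one_pos, (hx 1 (one_mem L) one_pos).le⟩

theorem isInfinitelySmall_inv {x : K} (hx : x ∉ nonInfinitelyLarge L) :
    IsInfinitelySmall L x⁻¹ := fun a ha h0 => by
  rw [mem_nonInfinitelyLarge] at hx
  push Not at hx
  rw [abs_inv]
  exact inv_lt_of_inv_lt₀ h0 (hx a⁻¹ (inv_mem ha) (inv_pos.2 h0))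

theorem inv_mem_nonInfinitelyLarge {x : K} (hx : ¬ IsInfinitelySmall L x) :
    x⁻¹ ∈ nonInfinitelyLarge L := by
  unfold IsInfinitelySmall at hx
  push Not at hx
  obtain ⟨a, ha, h0, hax⟩ := hx
  rw [mem_nonInfinitelyLarge]
  refine ⟨a⁻¹, inv_mem ha, inv_pos.2 h0, ?_⟩
  rw [abs_inv]
  exact inv_anti₀ h0 hax

theorem isUnit_of_notMem_infinitelySmallIdeal {x : nonInfinitelyLarge L}
    (hx : x ∉ infinitelySmallIdeal L) : IsUnit x := by
  have hx0 : (x : K) ≠ 0 := by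
    intro h
    rw [Subring.coe_eq_zero_iff] at h
    exact hx (h ▸ zero_mem _)
  exact IsUnit.of_mul_eq_one ⟨(x : K)⁻¹, inv_mem_nonInfinitelyLarge hx⟩
    (Subtype.ext (mul_inv_cancel₀ hx0))

theorem infinitelySmallIdeal_ne_top : infinitelySmallIdeal L ≠ ⊤ := by
  rw [Ideal.ne_top_iff_one]
  intro h
  have := h 1 (one_mem L) one_pos
  simp at this

instance : (infinitelySmallIdeal L).IsMaximal := by
  refine ⟨infinitelySmallIdeal_ne_top, fun J hJ => ?_⟩
  obtain ⟨x, hxJ, hx⟩ := Set.exists_of_ssubset hJ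
  exact J.eq_top_of_isUnit_mem hxJ (isUnit_of_notMem_infinitelySmallIdeal hx)

/-- Take a linear or quadratic factor over `K`. If its root, or its norm `a² + b²`, is not
infinitely large, the monic factor has coefficients in `A`. Otherwise dividing by its constant term
gives a polynomial over `A` that reduces to `1`. A monic quadratic reduces to a square if `b` is
infinitely small and stays irreducible if not. -/
theorem exists_mul_eq_of_natDegree_pos [IsRealClosed K] {f : (nonInfinitelyLarge L)[X]}
    (hf : 0 < f.natDegree) : ∃ p q : (nonInfinitelyLarge L)[X], f = p * q ∧
      q.natDegree < f.natDegree ∧ (p.map (Ideal.Quotient.mk (infinitelySmallIdeal L)) = 1 ∨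
        p.Monic ∧ ∃ (π : (nonInfinitelyLarge L ⧸ infinitelySmallIdeal L)[X]) (m : ℕ),
          Prime π ∧ p.map (Ideal.Quotient.mk (infinitelySmallIdeal L)) = π ^ m) := by
  let _ : Field (nonInfinitelyLarge L ⧸ infinitelySmallIdeal L) := Ideal.Quotient.field _
  let φ := (nonInfinitelyLarge L).subtype
  have hφ : Function.Injective φ := Subtype.val_injective
  have hf0 : f ≠ 0 := by rintro rfl; simp at hf
  suffices ∃ p : (nonInfinitelyLarge L)[X], p ∣ f ∧ 0 < p.natDegree ∧
      (p.map (Ideal.Quotient.mk (infinitelySmallIdeal L)) = 1 ∨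
        p.Monic ∧ ∃ (π : (nonInfinitelyLarge L ⧸ infinitelySmallIdeal L)[X]) (m : ℕ),
          Prime π ∧ p.map (Ideal.Quotient.mk (infinitelySmallIdeal L)) = π ^ m) by
    obtain ⟨p, ⟨q, rfl⟩, hp, h⟩ := this
    refine ⟨p, q, rfl, ?_, h⟩
    rw [natDegree_mul (left_ne_zero_of_mul hf0) (right_ne_zero_of_mul hf0)]
    omega
  have hmk : ∀ {x : K} (hx : IsInfinitelySmall L x),
      Ideal.Quotient.mk (infinitelySmallIdeal L) ⟨x, hx.mem⟩ = 0 := fun hx =>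
    Ideal.Quotient.eq_zero_iff_mem.2 hx
  rcases IsRealClosed.exists_dvd_of_natDegree_pos (f := f.map φ)
    (by rwa [natDegree_map_eq_of_injective hφ]) with ⟨a, ha⟩ | ⟨a, b, hb, hab⟩
  · by_cases haA : a ∈ nonInfinitelyLarge L
    · refine ⟨X - C ⟨a, haA⟩, ?_, by simp, .inr ⟨monic_X_sub_C _, X - C (Ideal.Quotient.mk _ ⟨a, haA⟩),
        1, prime_X_sub_C _, by simp⟩⟩
      rw [← map_dvd_map φ hφ (monic_X_sub_C _)]
      simpa [φ] using ha
    · have hs := isInfinitelySmall_inv haA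
      have ha0 : a ≠ 0 := by rintro rfl; exact haA (zero_mem _)
      refine ⟨1 - C ⟨a⁻¹, hs.mem⟩ * X, dvd_of_map_dvd_map_of_coeff_zero_eq_one hφ (by simp) ?_, ?_,
        .inl (by simp [hmk hs])⟩
      · refine dvd_trans ⟨C (-a), ?_⟩ ha
        have : C a⁻¹ * C a = (1 : K[X]) := by rw [← C_mul, inv_mul_cancel₀ ha0, C_1]
        simp [φ]
        linear_combination -X * this
      · refine lt_of_lt_of_le one_pos (le_natDegree_of_ne_zero (n := 1) ?_)
        simp [coeff_one, Subtype.ext_iff, ha0]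
  · have habs : |b ^ 2| ≤ |a ^ 2 + b ^ 2| ∧ |a ^ 2| ≤ |a ^ 2 + b ^ 2| := by
      rw [abs_of_nonneg (sq_nonneg b), abs_of_nonneg (sq_nonneg a),
        abs_of_nonneg (add_nonneg (sq_nonneg a) (sq_nonneg b))]
      constructor <;> linarith [sq_nonneg a, sq_nonneg b]
    by_cases hN : a ^ 2 + b ^ 2 ∈ nonInfinitelyLarge L
    · have haA := nonInfinitelyLarge_mem_of_sq (nonInfinitelyLarge_mem_of_le hN habs.2)
      have hbA := nonInfinitelyLarge_mem_of_sq (nonInfinitelyLarge_mem_of_le hN habs.1)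
      set α : nonInfinitelyLarge L := ⟨a, haA⟩
      set β : nonInfinitelyLarge L := ⟨b, hbA⟩
      have hm : ((X - C α) ^ 2 + C (β ^ 2)).Monic := by monicity!
      refine ⟨(X - C α) ^ 2 + C (β ^ 2), ?_, ?_, .inr ⟨hm, ?_⟩⟩
      · rw [← map_dvd_map φ hφ hm]
        simpa [φ, α, β] using hab
      · have : ((X - C α) ^ 2 + C (β ^ 2)).natDegree = 2 := by compute_degree!
        omega
      · by_cases hbs : IsInfinitelySmall L b
        · refine ⟨X - C (Ideal.Quotient.mk _ α), 2, prime_X_sub_C _, ?_⟩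
          have : Ideal.Quotient.mk (infinitelySmallIdeal L) β = 0 := hmk hbs
          simp [this]
        · refine ⟨_, 1, Irreducible.prime ?_, (pow_one _).symm⟩
          have hd : (((X - C α) ^ 2 + C (β ^ 2)).map
              (Ideal.Quotient.mk (infinitelySmallIdeal L))).natDegree = 2 := by
            rw [hm.natDegree_map]
            compute_degree!
          rw [(hm.map _).irreducible_iff_roots_eq_zero_of_degree_le_three hd.ge (by omega),
            Multiset.eq_zero_iff_forall_notMem]
          -- A root `c` modulo `M` would make `(c - a)² + b²`, and with it `b`, infinitely small.
          intro c hc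
          obtain ⟨c, rfl⟩ := Ideal.Quotient.mk_surjective c
          have hc := isRoot_of_mem_roots hc
          rw [IsRoot.def, eval_map, eval₂_at_apply, Ideal.Quotient.eq_zero_iff_mem] at hc
          have hc : IsInfinitelySmall L (((c : K) - a) ^ 2 + b ^ 2) := by
            simpa [α, β, mem_infinitelySmallIdeal] using hc
          refine hbs (hc.mono ?_).of_sq
          rw [abs_of_nonneg (sq_nonneg b), abs_of_nonneg (by positivity)]
          linarith [sq_nonneg ((c : K) - a)]
    · have hs := isInfinitelySmall_inv hN
      have hpos : 0 < a ^ 2 + b ^ 2 := by positivity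
      -- The square of this element is at most `(a² + b²)⁻¹`.
      have hs' : IsInfinitelySmall L (a * (a ^ 2 + b ^ 2)⁻¹) := by
        refine (hs.mono ?_).of_sq
        rw [abs_of_nonneg (by positivity), abs_of_nonneg (by positivity)]
        field_simp
        nlinarith [sq_nonneg b]
      refine ⟨C ⟨_, hs.mem⟩ * X ^ 2 - 2 * C ⟨_, hs'.mem⟩ * X + 1,
        dvd_of_map_dvd_map_of_coeff_zero_eq_one hφ (by simp [coeff_zero_eq_eval_zero]) ?_, ?_,
        .inl (by simp [hmk hs, hmk hs'])⟩
      · refine dvd_trans ⟨C (a ^ 2 + b ^ 2), ?_⟩ hab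
        have : C (a ^ 2 + b ^ 2)⁻¹ * C (a ^ 2 + b ^ 2) = (1 : K[X]) := by
          rw [← C_mul, inv_mul_cancel₀ hpos.ne', C_1]
        simp only [φ, Polynomial.map_add, Polynomial.map_sub, Polynomial.map_mul, Polynomial.map_pow,
          Polynomial.map_ofNat, Polynomial.map_one, map_X, map_C, Subring.subtype_apply, C_mul]
        simp only [C_add, C_pow] at this ⊢
        linear_combination (2 * X * C a - X ^ 2) * this
      · refine lt_of_lt_of_le two_pos (le_natDegree_of_ne_zero (n := 2) ?_)
        have h2 : (2 : (nonInfinitelyLarge L)[X]) = C 2 := rfl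
        rw [h2, ← C_mul]
        simp [coeff_one, Subtype.ext_iff, hpos.ne']

theorem liftsCoprimeFactorizations_infinitelySmallIdeal [IsRealClosed K] :
    LiftsCoprimeFactorizations (infinitelySmallIdeal L) :=
  .of_forall_exists_mul_eq fun _ hf => exists_mul_eq_of_natDegree_pos hf

end ConvexSubring

/-! ### Restricted series over a linearly topologized ring. -/

section RestrictedSeries

variable {A : Type*} [CommRing A]

theorem PowerSeries.map_mk_trunc_eq {I : Ideal A} {S : PowerSeries A} {N : ℕ}
    (hN : ∀ n ≥ N, coeff n S ∈ I) {n : ℕ} (hn : N ≤ n) :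
    (((trunc n S).map (Ideal.Quotient.mk I) : (A ⧸ I)[X]) : PowerSeries (A ⧸ I)) =
      S.map (Ideal.Quotient.mk I) := by
  ext k
  rw [Polynomial.coeff_coe, Polynomial.coeff_map, coeff_trunc, coeff_map]
  split_ifs with h
  · rfl
  · rw [map_zero, Ideal.Quotient.eq_zero_iff_mem.2 (hN k (by omega))]

/-- Nakayama for `A[X] / (p)`, which is a finite `A`-module because `p` is monic: the ideal
generated by `t` is everything modulo `M`, hence everything. -/
theorem Polynomial.IsCoprime.of_map_mk {M : Ideal A} (hM : M ≤ Ideal.jacobson ⊥)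
    {p t : A[X]} (hp : p.Monic)
    (h : IsCoprime (p.map (Ideal.Quotient.mk M)) (t.map (Ideal.Quotient.mk M))) :
    IsCoprime p t := by
  have := hp.finite_adjoinRoot
  obtain ⟨u', v', huv⟩ := h
  obtain ⟨u, rfl⟩ := map_surjective _ Ideal.Quotient.mk_surjective u'
  obtain ⟨v, rfl⟩ := map_surjective _ Ideal.Quotient.mk_surjective v'
  rw [← Polynomial.map_mul, ← Polynomial.map_mul, ← Polynomial.map_add] at huv
  have hw : ∀ k, (1 - (u * p + v * t)).coeff k ∈ M := fun k => by
    rw [← Ideal.Quotient.eq_zero_iff_mem, ← Polynomial.coeff_map, Polynomial.map_sub, huv]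
    simp
  have hw' : AdjoinRoot.mk p (1 - (u * p + v * t)) ∈ M • (⊤ : Submodule A (AdjoinRoot p)) := by
    rw [as_sum_range_C_mul_X_pow (1 - (u * p + v * t)), map_sum]
    refine Submodule.sum_mem _ fun k _ => ?_
    rw [map_mul, AdjoinRoot.mk_C, ← AdjoinRoot.algebraMap_eq, ← Algebra.smul_def]
    exact Submodule.smul_mem_smul (hw k) trivial
  let J : Submodule A (AdjoinRoot p) := (Ideal.span {AdjoinRoot.mk p t}).restrictScalars A
  have hJ : (⊤ : Submodule A (AdjoinRoot p)) ≤ J := by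
    refine Submodule.le_of_le_smul_of_le_jacobson_bot Module.Finite.fg_top hM fun b _ => ?_
    have hb : b = b * AdjoinRoot.mk p v * AdjoinRoot.mk p t +
        b * AdjoinRoot.mk p (1 - (u * p + v * t)) := by
      simp only [map_sub, map_add, map_mul, map_one, AdjoinRoot.mk_self]
      ring
    rw [hb]
    refine add_mem (Submodule.mem_sup_left ?_) (Submodule.mem_sup_right ?_)
    · exact Ideal.mul_mem_left _ _ (Ideal.mem_span_singleton_self _)
    · refine Submodule.smul_induction_on hw' (fun r hr n _ => ?_) fun x y hx hy => ?_
      · rw [mul_smul_comm]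
        exact Submodule.smul_mem_smul hr trivial
      · rw [mul_add]
        exact add_mem hx hy
  obtain ⟨c, hc⟩ := Ideal.mem_span_singleton'.1 (hJ (x := 1) trivial)
  obtain ⟨c, rfl⟩ := AdjoinRoot.mk_surjective c
  rw [← map_mul, ← map_one (AdjoinRoot.mk p), AdjoinRoot.mk_eq_mk] at hc
  obtain ⟨d, hd⟩ := hc
  exact ⟨-d, c, by linear_combination hd⟩

variable [TopologicalSpace A]

/-- The quotient by an open ideal is discrete, so the coefficients are eventually zero. -/
theorem IsRestrictedSeries.exists_eq_coe_of_isOpen {M : Ideal A} (hM : IsOpen (M : Set A))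
    {T : PowerSeries (A ⧸ M)} (hT : IsRestrictedSeries T) : ∃ p : (A ⧸ M)[X], T = p := by
  have hopen : IsOpen ({0} : Set (A ⧸ M)) := by
    have : Ideal.Quotient.mk M ⁻¹' {0} = M := Set.ext fun _ => Ideal.Quotient.eq_zero_iff_mem
    rw [← this] at hM
    exact isOpen_coinduced.2 hM
  obtain ⟨N, hN⟩ := Filter.eventually_atTop.1 (hT (hopen.mem_nhds rfl))
  refine ⟨PowerSeries.trunc N T, ?_⟩
  ext k
  rw [Polynomial.coeff_coe, PowerSeries.coeff_trunc]
  split_ifs with h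
  · rfl
  · exact hN k (by omega)

theorem PowerSeries.ext_of_forall_map_mk_eq
    (hsep : ∀ x : A, (∀ I : Ideal A, IsOpen (I : Set A) → x ∈ I) → x = 0) {S T : PowerSeries A}
    (h : ∀ I : Ideal A, IsOpen (I : Set A) →
      S.map (Ideal.Quotient.mk I) = T.map (Ideal.Quotient.mk I)) : S = T := by
  ext k
  rw [← sub_eq_zero]
  refine hsep _ fun I hI => ?_
  have := congrArg (coeff k) (h I hI)
  rw [coeff_map, coeff_map] at this
  exact Ideal.Quotient.eq.1 this

theorem Polynomial.ext_of_forall_map_mk_eq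
    (hsep : ∀ x : A, (∀ I : Ideal A, IsOpen (I : Set A) → x ∈ I) → x = 0) {p q : A[X]}
    (h : ∀ I : Ideal A, IsOpen (I : Set A) →
      p.map (Ideal.Quotient.mk I) = q.map (Ideal.Quotient.mk I)) : p = q := by
  rw [← Polynomial.coe_inj]
  exact PowerSeries.ext_of_forall_map_mk_eq hsep fun I hI => by
    rw [← polynomial_map_coe, h I hI, polynomial_map_coe]

/-- Every sequence of `A` that is Cauchy modulo all open ideals converges modulo all open ideals. -/
def IsSeqCompleteLinear (A : Type*) [CommRing A] [TopologicalSpace A] : Prop :=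
  ∀ a : ℕ → A, (∀ I : Ideal A, IsOpen (I : Set A) → ∃ N, ∀ n ≥ N, a n - a N ∈ I) →
    ∃ x, ∀ I : Ideal A, IsOpen (I : Set A) → ∃ N, ∀ n ≥ N, a n - x ∈ I

variable [IsTopologicalRing A] [IsLinearTopology A A]

theorem isRestrictedSeries_iff_forall_isOpen {S : PowerSeries A} :
    IsRestrictedSeries S ↔
      ∀ I : Ideal A, IsOpen (I : Set A) → ∃ N, ∀ n ≥ N, PowerSeries.coeff n S ∈ I := by
  rw [IsRestrictedSeries, IsLinearTopology.hasBasis_open_ideal.tendsto_right_iff]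
  simp [Filter.eventually_atTop]

/-- This form reduces closure properties and divisibility to polynomial rings over the quotients `A
⧸ I`. -/
theorem isRestrictedSeries_iff_forall_exists_map_eq_coe {S : PowerSeries A} :
    IsRestrictedSeries S ↔ ∀ I : Ideal A, IsOpen (I : Set A) →
      ∃ p : (A ⧸ I)[X], S.map (Ideal.Quotient.mk I) = p := by
  rw [isRestrictedSeries_iff_forall_isOpen]
  refine ⟨fun h I hI => ?_, fun h I hI => ?_⟩
  · obtain ⟨N, hN⟩ := h I hI
    exact ⟨_, (PowerSeries.map_mk_trunc_eq hN le_rfl).symm⟩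
  · obtain ⟨p, hp⟩ := h I hI
    refine ⟨p.natDegree + 1, fun n hn => ?_⟩
    rw [← Ideal.Quotient.eq_zero_iff_mem, ← PowerSeries.coeff_map, hp, Polynomial.coeff_coe]
    exact coeff_eq_zero_of_natDegree_lt hn

theorem IsRestrictedSeries.coe_polynomial (p : A[X]) : IsRestrictedSeries (p : PowerSeries A) :=
  isRestrictedSeries_iff_forall_exists_map_eq_coe.2 fun I _ =>
    ⟨p.map (Ideal.Quotient.mk I), (polynomial_map_coe).symm⟩

theorem IsRestrictedSeries.mul {S T : PowerSeries A} (hS : IsRestrictedSeries S)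
    (hT : IsRestrictedSeries T) : IsRestrictedSeries (S * T) := by
  rw [isRestrictedSeries_iff_forall_exists_map_eq_coe] at *
  intro I hI
  obtain ⟨p, hp⟩ := hS I hI
  obtain ⟨q, hq⟩ := hT I hI
  exact ⟨p * q, by rw [map_mul, hp, hq, Polynomial.coe_mul]⟩

theorem IsRestrictedSeries.add {S T : PowerSeries A} (hS : IsRestrictedSeries S)
    (hT : IsRestrictedSeries T) : IsRestrictedSeries (S + T) := by
  rw [isRestrictedSeries_iff_forall_exists_map_eq_coe] at *
  intro I hI
  obtain ⟨p, hp⟩ := hS I hI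
  obtain ⟨q, hq⟩ := hT I hI
  exact ⟨p + q, by rw [map_add, hp, hq, Polynomial.coe_add]⟩

theorem IsRestrictedSeries.neg {S : PowerSeries A} (hS : IsRestrictedSeries S) :
    IsRestrictedSeries (-S) := by
  have h : -S = ((-1 : A[X]) : PowerSeries A) * S := by simp
  rw [h]
  exact (IsRestrictedSeries.coe_polynomial _).mul hS

/-- A sequence of polynomials that is uniformly Cauchy converges to a restricted series. -/
theorem IsSeqCompleteLinear.exists_map_eq_map (hA : IsSeqCompleteLinear A) (q : ℕ → A[X])
    (hq : ∀ I : Ideal A, IsOpen (I : Set A) → ∃ N, ∀ n ≥ N,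
      (q n).map (Ideal.Quotient.mk I) = (q N).map (Ideal.Quotient.mk I)) :
    ∃ Y : PowerSeries A, IsRestrictedSeries Y ∧ ∀ I : Ideal A, IsOpen (I : Set A) → ∀ N,
      (∀ n ≥ N, (q n).map (Ideal.Quotient.mk I) = (q N).map (Ideal.Quotient.mk I)) →
        Y.map (Ideal.Quotient.mk I) = ((q N).map (Ideal.Quotient.mk I) : (A ⧸ I)[X]) := by
  have hcoeff : ∀ {I : Ideal A} {m n : ℕ},
      (q n).map (Ideal.Quotient.mk I) = (q m).map (Ideal.Quotient.mk I) →
      ∀ k, (q n).coeff k - (q m).coeff k ∈ I := fun h k => by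
    rw [← Ideal.Quotient.eq, ← Polynomial.coeff_map, h, Polynomial.coeff_map]
  choose y hy using fun k => hA (fun n => (q n).coeff k) fun I hI => by
    obtain ⟨N, hN⟩ := hq I hI
    exact ⟨N, fun n hn => hcoeff (hN n hn) k⟩
  have key : ∀ I : Ideal A, IsOpen (I : Set A) → ∀ N,
      (∀ n ≥ N, (q n).map (Ideal.Quotient.mk I) = (q N).map (Ideal.Quotient.mk I)) →
        (PowerSeries.mk y).map (Ideal.Quotient.mk I) =
          ((q N).map (Ideal.Quotient.mk I) : (A ⧸ I)[X]) := by
    intro I hI N hN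
    ext k
    rw [PowerSeries.coeff_map, PowerSeries.coeff_mk, Polynomial.coeff_coe, Polynomial.coeff_map,
      eq_comm, Ideal.Quotient.eq]
    obtain ⟨N', hN'⟩ := hy k I hI
    have h1 := hN' (max N N') (le_max_right _ _)
    have h2 := hcoeff (hN (max N N') (le_max_left _ _)) k
    convert I.sub_mem h1 h2 using 1
    ring
  refine ⟨PowerSeries.mk y, ?_, key⟩
  rw [isRestrictedSeries_iff_forall_exists_map_eq_coe]
  intro I hI
  obtain ⟨N, hN⟩ := hq I hI
  exact ⟨_, key I hI N hN⟩

/-- Division with remainder of a restricted series by a monic polynomial. -/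
theorem IsRestrictedSeries.exists_eq_mul_add [Nontrivial A] (hA : IsSeqCompleteLinear A)
    (hsep : ∀ x : A, (∀ I : Ideal A, IsOpen (I : Set A) → x ∈ I) → x = 0) {T : PowerSeries A}
    (hT : IsRestrictedSeries T) {P : A[X]} (hP : P.Monic) :
    ∃ (Y : PowerSeries A) (r : A[X]), IsRestrictedSeries Y ∧ r.degree < P.degree ∧
      T = P * Y + r := by
  rw [isRestrictedSeries_iff_forall_isOpen] at hT
  -- Division by a monic polynomial commutes with reduction modulo `I`, so the quotients of the
  -- truncations stabilise there.
  have hq : ∀ (I : Ideal A) (N : ℕ), (∀ n ≥ N, PowerSeries.coeff n T ∈ I) → ∀ n ≥ N,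
      (PowerSeries.trunc n T /ₘ P).map (Ideal.Quotient.mk I) =
        (PowerSeries.trunc N T /ₘ P).map (Ideal.Quotient.mk I) := by
    intro I N hN n hn
    rw [map_divByMonic _ hP, map_divByMonic _ hP]
    congr 1
    rw [← Polynomial.coe_inj, PowerSeries.map_mk_trunc_eq hN hn,
      PowerSeries.map_mk_trunc_eq hN le_rfl]
  obtain ⟨Y, hY, hYq⟩ := hA.exists_map_eq_map (fun n => PowerSeries.trunc n T /ₘ P) fun I hI => by
    obtain ⟨N, hN⟩ := hT I hI
    exact ⟨N, hq I N hN⟩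
  have hr : T - P * Y = (PowerSeries.trunc P.natDegree (T - P * Y) : A[X]) := by
    ext k
    rw [Polynomial.coeff_coe, PowerSeries.coeff_trunc]
    split_ifs with hk
    · rfl
    refine hsep _ fun I hI => ?_
    obtain ⟨N, hN⟩ := hT I hI
    rw [← Ideal.Quotient.eq_zero_iff_mem, ← PowerSeries.coeff_map, map_sub, map_mul,
      hYq I hI N (hq I N hN), ← PowerSeries.map_mk_trunc_eq hN le_rfl, ← polynomial_map_coe,
      ← Polynomial.coe_mul, ← Polynomial.coe_sub, ← Polynomial.map_mul, ← Polynomial.map_sub,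
      Polynomial.coeff_coe, Polynomial.coeff_map]
    have h1 : PowerSeries.trunc N T - P * (PowerSeries.trunc N T /ₘ P) =
        PowerSeries.trunc N T %ₘ P := by
      rw [sub_eq_iff_eq_add]
      exact (modByMonic_add_div _ P).symm
    rw [h1, coeff_eq_zero_of_degree_lt, map_zero]
    refine (degree_modByMonic_lt _ hP).trans_le (degree_le_natDegree.trans ?_)
    exact_mod_cast not_lt.1 hk
  refine ⟨Y, _, hY, ?_, (sub_eq_iff_eq_add'.1 hr)⟩
  rw [degree_eq_natDegree hP.ne_zero]
  exact PowerSeries.degree_trunc_lt _ _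

/-- Nakayama needs polynomials, so `T = P * Y + r` is replaced by its remainder `r`. A relation `u *
P + v * r = 1` then becomes `(u - v * Y) * P + v * T = 1`. -/
theorem AreCoprimeRestricted.of_isCoprime_map [Nontrivial A] (hA : IsSeqCompleteLinear A)
    (hsep : ∀ x : A, (∀ I : Ideal A, IsOpen (I : Set A) → x ∈ I) → x = 0)
    {M : Ideal A} (hM : M ≤ Ideal.jacobson ⊥) (hMo : IsOpen (M : Set A)) {P : A[X]} (hP : P.Monic)
    {T : PowerSeries A} (hT : IsRestrictedSeries T) {t' : (A ⧸ M)[X]}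
    (hTt : T.map (Ideal.Quotient.mk M) = t')
    (hco : IsCoprime (P.map (Ideal.Quotient.mk M)) t') :
    AreCoprimeRestricted (P : PowerSeries A) T := by
  obtain ⟨Y, r, hY, -, rfl⟩ := hT.exists_eq_mul_add hA hsep hP
  obtain ⟨y, hy⟩ := isRestrictedSeries_iff_forall_exists_map_eq_coe.1 hY M hMo
  have ht' : t' = P.map (Ideal.Quotient.mk M) * y + r.map (Ideal.Quotient.mk M) := by
    rw [← Polynomial.coe_inj, ← hTt, map_add, map_mul, hy, Polynomial.coe_add, Polynomial.coe_mul,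
      polynomial_map_coe, polynomial_map_coe]
  rw [ht', IsCoprime.mul_add_left_right_iff] at hco
  obtain ⟨u, v, huv⟩ := Polynomial.IsCoprime.of_map_mk hM hP hco
  refine ⟨(u : PowerSeries A) + -((v : PowerSeries A) * Y), v,
    (IsRestrictedSeries.coe_polynomial _).add
      ((IsRestrictedSeries.coe_polynomial _).mul hY).neg, IsRestrictedSeries.coe_polynomial _, ?_⟩
  have := congrArg (fun p : A[X] => (p : PowerSeries A)) huv
  simp only [Polynomial.coe_add, Polynomial.coe_mul, Polynomial.coe_one] at this
  linear_combination this

/-- Modulo an open ideal, the monic factor of a coprime factorization is unique. -/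
theorem Polynomial.map_mk_eq_of_map_mul_eq {I : Ideal A} (hI : IsOpen (I : Set A)) {P Q : A[X]}
    (hP : P.Monic) (hQ : Q.Monic) (hd : P.natDegree = Q.natDegree) {T W : PowerSeries A}
    (hT : IsRestrictedSeries T) (hco : AreCoprimeRestricted (P : PowerSeries A) W)
    (h : ((P : PowerSeries A) * T).map (Ideal.Quotient.mk I) =
      ((Q : PowerSeries A) * W).map (Ideal.Quotient.mk I)) :
    P.map (Ideal.Quotient.mk I) = Q.map (Ideal.Quotient.mk I) := by
  obtain ⟨U, V, hU, hV, hUV⟩ := hco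
  obtain ⟨y, hy⟩ := isRestrictedSeries_iff_forall_exists_map_eq_coe.1
    (((IsRestrictedSeries.coe_polynomial Q).mul hU).add (hV.mul hT)) I hI
  -- Multiply `U * P + V * W = 1` by `Q` and replace `Q * W` by `P * T`: modulo `I`, `Q = P * (Q * U
  -- + V * T)`.
  have hdvd : P.map (Ideal.Quotient.mk I) ∣ Q.map (Ideal.Quotient.mk I) := by
    refine ⟨y, ?_⟩
    rw [← Polynomial.coe_inj, Polynomial.coe_mul, ← hy, polynomial_map_coe, polynomial_map_coe]
    have := congrArg (PowerSeries.map (Ideal.Quotient.mk I)) hUV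
    simp only [map_add, map_mul, map_one] at this h ⊢
    linear_combination (-PowerSeries.map (Ideal.Quotient.mk I) (Q : PowerSeries A)) * this -
      PowerSeries.map (Ideal.Quotient.mk I) V * h
  nontriviality (A ⧸ I)
  refine (eq_of_monic_of_dvd_of_natDegree_le (hP.map _) (hQ.map _) hdvd ?_).symm
  rw [hP.natDegree_map, hQ.natDegree_map, hd]

theorem SatisfiesHenselRestricted.of_liftsCoprimeFactorizations [IsDomain A]
    (hA : IsSeqCompleteLinear A)
    (hsep : ∀ x : A, (∀ I : Ideal A, IsOpen (I : Set A) → x ∈ I) → x = 0)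
    {M : Ideal A} [hmax : M.IsMaximal] (hM : M ≤ Ideal.jacobson ⊥) (hMo : IsOpen (M : Set A))
    (hlift : LiftsCoprimeFactorizations M) : SatisfiesHenselRestricted A M := by
  let _ : Field (A ⧸ M) := Ideal.Quotient.field M
  intro S P' T' hS hP' hT' hco hST
  obtain ⟨h', rfl⟩ := hT'.exists_eq_coe_of_isOpen hMo
  replace hco : IsCoprime P' h' := by
    obtain ⟨U, V, hU, hV, hUV⟩ := hco
    obtain ⟨u, rfl⟩ := hU.exists_eq_coe_of_isOpen hMo
    obtain ⟨v, rfl⟩ := hV.exists_eq_coe_of_isOpen hMo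
    exact ⟨u, v, by exact_mod_cast hUV⟩
  have hS' := isRestrictedSeries_iff_forall_isOpen.1 hS
  obtain ⟨N₁, hN₁⟩ := hS' M hMo
  -- The shift by `N₁` makes every truncation, including the one for `n = 0`, agree with `S` modulo
  -- `M`.
  choose g h hg hgm hhm hgh using fun n => hlift (PowerSeries.trunc (n + N₁) S) P' h' hP' hco (by
    rw [← Polynomial.coe_inj, PowerSeries.map_mk_trunc_eq hN₁ (Nat.le_add_left _ _), hST,
      Polynomial.coe_mul])
  have hdeg : ∀ {p : A[X]}, p.Monic → p.map (Ideal.Quotient.mk M) = P' →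
      p.natDegree = P'.natDegree := fun hp h => by rw [← h, hp.natDegree_map]
  have hSgh : ∀ {I : Ideal A} {N : ℕ}, (∀ n ≥ N, PowerSeries.coeff n S ∈ I) → ∀ n ≥ N,
      S.map (Ideal.Quotient.mk I) =
        ((g n : PowerSeries A) * (h n : PowerSeries A)).map (Ideal.Quotient.mk I) := by
    intro I N hN n hn
    rw [← PowerSeries.map_mk_trunc_eq hN (hn.trans (Nat.le_add_right n N₁)), hgh n,
      ← Polynomial.coe_mul, polynomial_map_coe]
  have hcoh : ∀ {p : A[X]}, p.Monic → p.map (Ideal.Quotient.mk M) = P' →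
      ∀ {W : PowerSeries A}, IsRestrictedSeries W → W.map (Ideal.Quotient.mk M) = h' →
      AreCoprimeRestricted (p : PowerSeries A) W := fun hp hpm _ hW hWm =>
    .of_isCoprime_map hA hsep hM hMo hp hW hWm (hpm ▸ hco)
  have hgN : ∀ {I : Ideal A}, IsOpen (I : Set A) → ∀ {N : ℕ},
      (∀ n ≥ N, PowerSeries.coeff n S ∈ I) → ∀ n ≥ N,
      (g n).map (Ideal.Quotient.mk I) = (g N).map (Ideal.Quotient.mk I) := by
    intro I hI N hN n hn
    refine map_mk_eq_of_map_mul_eq hI (hg n) (hg N)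
      ((hdeg (hg n) (hgm n)).trans (hdeg (hg N) (hgm N)).symm)
      (IsRestrictedSeries.coe_polynomial (h n))
      (hcoh (hg n) (hgm n) (IsRestrictedSeries.coe_polynomial (h N)) ?_)
      ((hSgh hN n hn).symm.trans (hSgh hN N le_rfl))
    rw [← polynomial_map_coe, hhm]
  obtain ⟨Y, -, hY⟩ := hA.exists_map_eq_map g fun I hI => by
    obtain ⟨N, hN⟩ := hS' I hI
    exact ⟨N, hgN hI hN⟩
  -- All `g n` are monic of degree `P'.natDegree`, so their limit is too.
  obtain ⟨P, rfl, hP⟩ : ∃ P : A[X], Y = P ∧ P.Monic := by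
    have hcoeff : ∀ k, P'.natDegree ≤ k →
        PowerSeries.coeff k Y = if k = P'.natDegree then 1 else 0 := by
      intro k hk
      rw [← sub_eq_zero]
      refine hsep _ fun I hI => ?_
      obtain ⟨N, hN⟩ := hS' I hI
      rw [← Ideal.Quotient.eq, ← PowerSeries.coeff_map, hY I hI N (hgN hI hN),
        Polynomial.coeff_coe, Polynomial.coeff_map]
      congr 1
      split_ifs with hk'
      · rw [hk', ← hdeg (hg N) (hgm N)]
        exact (hg N).coeff_natDegree
      · apply coeff_eq_zero_of_natDegree_lt
        rw [hdeg (hg N) (hgm N)]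
        omega
    refine ⟨PowerSeries.trunc (P'.natDegree + 1) Y, ?_, ?_⟩
    · ext k
      rw [Polynomial.coeff_coe, PowerSeries.coeff_trunc]
      split_ifs with hk
      · rfl
      · rw [hcoeff k (by omega), if_neg (by omega)]
    · refine monic_of_natDegree_le_of_coeff_eq_one P'.natDegree
        (Nat.lt_succ_iff.1 (PowerSeries.natDegree_trunc_lt _ _)) ?_
      rw [PowerSeries.coeff_trunc, if_pos (Nat.lt_succ_self _), hcoeff _ le_rfl, if_pos rfl]
  have hPg : ∀ {I : Ideal A}, IsOpen (I : Set A) → ∀ {N : ℕ},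
      (∀ n ≥ N, PowerSeries.coeff n S ∈ I) →
      P.map (Ideal.Quotient.mk I) = (g N).map (Ideal.Quotient.mk I) := fun hI N hN => by
    rw [← Polynomial.coe_inj, polynomial_map_coe]
    exact hY _ hI N (hgN hI hN)
  have hPm : P.map (Ideal.Quotient.mk M) = P' := (hPg hMo hN₁).trans (hgm N₁)
  obtain ⟨T, r, hT, hr, hSPT⟩ := hS.exists_eq_mul_add hA hsep hP
  -- Modulo `I`, `P` agrees with some `g N` and so divides `S`, hence also the remainder `r`, whose
  -- degree is smaller. Only the `g n` need to converge; the cofactor comes from this division.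
  have hr0 : r = 0 := by
    refine ext_of_forall_map_mk_eq hsep fun I hI => ?_
    obtain ⟨N, hN⟩ := hS' I hI
    obtain ⟨y, hy⟩ := isRestrictedSeries_iff_forall_exists_map_eq_coe.1 hT I hI
    rw [← (modByMonic_eq_self_iff hP).2 hr, map_modByMonic _ hP, Polynomial.map_zero,
      modByMonic_eq_zero_iff_dvd (hP.map _)]
    refine ⟨(h N).map (Ideal.Quotient.mk I) - y, ?_⟩
    have h1 := hSgh hN N le_rfl
    rw [hSPT, map_add, map_mul, map_mul, hy, ← polynomial_map_coe, ← polynomial_map_coe,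
      ← polynomial_map_coe, ← polynomial_map_coe, ← hPg hI hN] at h1
    have h2 : P.map (Ideal.Quotient.mk I) * y + r.map (Ideal.Quotient.mk I) =
      P.map (Ideal.Quotient.mk I) * (h N).map (Ideal.Quotient.mk I) := by exact_mod_cast h1
    linear_combination h2
  rw [hr0, Polynomial.coe_zero, add_zero] at hSPT
  have hTm : T.map (Ideal.Quotient.mk M) = h' := by
    have hP0 : (P' : PowerSeries (A ⧸ M)) ≠ 0 := by
      rw [Ne, Polynomial.coe_eq_zero_iff]
      exact hP'.ne_zero
    apply mul_left_cancel₀ hP0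
    rw [← hST, hSPT, map_mul, ← polynomial_map_coe, hPm]
  refine ⟨P, T, ⟨hP, hT, hPm, hTm, hSPT⟩, hcoh hP hPm hT hTm, fun Q W hQW => ?_⟩
  -- Uniqueness holds modulo each open ideal, and these intersect in `0`; `T` then follows by
  -- cancelling `P` in a domain.
  have hPQ : P = Q := ext_of_forall_map_mk_eq hsep fun I hI =>
    map_mk_eq_of_map_mul_eq hI hP hQW.monic
      ((hdeg hP hPm).trans (hdeg hQW.monic hQW.map_left).symm) hT
      (hcoh hP hPm hQW.restricted hQW.map_right) (by rw [← hSPT, ← hQW.eq_mul])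
  subst hPQ
  refine ⟨rfl, mul_left_cancel₀ (a := (P : PowerSeries A)) ?_ (hQW.eq_mul.symm.trans hSPT)⟩
  rw [Ne, Polynomial.coe_eq_zero_iff]
  exact hP.ne_zero

end RestrictedSeries

/-! ### The order topology on `A`. -/

section ConvexTopology

variable {K : Type*} [Field K] [LinearOrder K] [IsStrictOrderedRing K] {L : Subfield K}

theorem IsNonComparable.exists_pos_lt_inv (hL : IsNonComparable L) :
    ∃ t : K, 0 < t ∧ t < 1 ∧ ∀ a ∈ L, a < t⁻¹ := by
  obtain ⟨x, hx⟩ := hL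
  have h1 := hx 1 (one_mem L)
  have h0 := one_pos.trans h1
  exact ⟨x⁻¹, inv_pos.2 h0, inv_lt_one_of_one_lt₀ h1, fun a ha => by rw [inv_inv]; exact hx a ha⟩

theorem infinitelySmallIdeal_le_jacobson_bot :
    infinitelySmallIdeal L ≤ Ideal.jacobson ⊥ := fun x hx => by
  rw [Ideal.mem_jacobson_bot]
  refine fun y => isUnit_of_notMem_infinitelySmallIdeal fun h => ?_
  refine infinitelySmallIdeal_ne_top ((Ideal.eq_top_iff_one (infinitelySmallIdeal L)).2 ?_)
  simpa using Ideal.sub_mem _ h (Ideal.mul_mem_right y _ hx)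

variable [TopologicalSpace K] [OrderTopology K]

theorem hasBasis_nhds_zero_nonInfinitelyLarge :
    (nhds (0 : nonInfinitelyLarge L)).HasBasis (fun ε : K => 0 < ε) fun ε => {x | |(x : K)| < ε} := by
  rw [nhds_subtype_eq_comap]
  simpa using (nhds_basis_abs_sub_lt (0 : K)).comap (Subtype.val : nonInfinitelyLarge L → K)

/-- Non-comparability provides `t > 0` with `|y| * t < 1` for all `y ∈ A`, so the multiples of `min
ε 1 * t` stay below `ε`. Conversely, `|x| < |c|` gives `x / c ∈ A`, so every nonzero principal ideal
contains a ball. -/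
theorem hasBasis_nhds_zero_span_singleton (hL : IsNonComparable L) :
    (nhds (0 : nonInfinitelyLarge L)).HasBasis (fun c : nonInfinitelyLarge L => c ≠ 0)
      fun c => (Ideal.span {c} : Set (nonInfinitelyLarge L)) := by
  refine hasBasis_nhds_zero_nonInfinitelyLarge.to_hasBasis (fun ε hε => ?_) fun c hc => ?_
  · obtain ⟨t, h0, h1, ht⟩ := hL.exists_pos_lt_inv
    have hm : 0 < min ε 1 := lt_min hε one_pos
    have hc : 0 < min ε 1 * t := mul_pos hm h0
    have hc1 : |min ε 1 * t| ≤ 1 := by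
      rw [abs_of_pos hc]
      exact mul_le_one₀ (min_le_right _ _) h0.le h1.le
    refine ⟨⟨min ε 1 * t, mem_nonInfinitelyLarge.2 ⟨1, one_mem L, one_pos, hc1⟩⟩, ?_, ?_⟩
    · exact fun h => hc.ne' (congrArg Subtype.val h)
    · intro x hx
      obtain ⟨y, rfl⟩ := Ideal.mem_span_singleton'.1 hx
      obtain ⟨a, ha, -, hya⟩ := mem_nonInfinitelyLarge.1 y.2
      change |(y : K) * (min ε 1 * t)| < ε
      rw [abs_mul, abs_of_pos hc]
      calc |(y : K)| * (min ε 1 * t) < t⁻¹ * (min ε 1 * t) :=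
            mul_lt_mul_of_pos_right (hya.trans_lt (ht a ha)) hc
        _ = min ε 1 := by field_simp
        _ ≤ ε := min_le_left _ _
  · have hc' : (c : K) ≠ 0 := fun h => hc (Subtype.ext h)
    refine ⟨|(c : K)|, abs_pos.2 hc', fun x hx => ?_⟩
    have hxc : |(x : K) / c| ≤ 1 := by
      rw [abs_div, div_le_one (abs_pos.2 hc')]
      exact le_of_lt hx
    refine Ideal.mem_span_singleton'.2
      ⟨⟨(x : K) / c, mem_nonInfinitelyLarge.2 ⟨1, one_mem L, one_pos, hxc⟩⟩, Subtype.ext ?_⟩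
    exact div_mul_cancel₀ _ hc'

theorem isLinearTopology_nonInfinitelyLarge (hL : IsNonComparable L) :
    IsLinearTopology (nonInfinitelyLarge L) (nonInfinitelyLarge L) :=
  .mk_of_hasBasis _ (hasBasis_nhds_zero_span_singleton hL)

theorem isOpen_infinitelySmallIdeal (hL : IsNonComparable L) :
    IsOpen (infinitelySmallIdeal L : Set (nonInfinitelyLarge L)) := by
  obtain ⟨t, h0, -, ht⟩ := hL.exists_pos_lt_inv
  refine (infinitelySmallIdeal L).toAddSubgroup.isOpen_of_mem_nhds (g := 0) ?_
  refine hasBasis_nhds_zero_nonInfinitelyLarge.mem_iff.2 ⟨t, h0, fun x hx a ha ha0 => ?_⟩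
  exact lt_trans hx ((inv_lt_inv₀ ha0 h0).1 (ht _ (inv_mem ha)))

/-- `A` contains the unit ball, so it is an open subgroup of `K`, and open subgroups are closed. -/
theorem isClosed_nonInfinitelyLarge : IsClosed (nonInfinitelyLarge L : Set K) := by
  refine (nonInfinitelyLarge L).toAddSubgroup.isClosed_of_isOpen ?_
  refine (nonInfinitelyLarge L).toAddSubgroup.isOpen_of_mem_nhds (g := 0) ?_
  refine (nhds_basis_abs_sub_lt (0 : K)).mem_iff.2 ⟨1, one_pos, fun x hx => ?_⟩
  rw [Set.mem_ofPred_eq, sub_zero] at hx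
  exact mem_nonInfinitelyLarge.2 ⟨1, one_mem L, one_pos, hx.le⟩

end ConvexTopology

/-- Open ideals are a basis at `0`, so such a sequence is Cauchy in `K`; its limit stays in the
closed subring `A`. -/
theorem isSeqCompleteLinear_nonInfinitelyLarge {K : Type*} [Field K] [LinearOrder K]
    [IsStrictOrderedRing K] {L : Subfield K} [UniformSpace K] [IsUniformAddGroup K]
    [OrderTopology K] [CompleteSpace K] (hL : IsNonComparable L) :
    IsSeqCompleteLinear (nonInfinitelyLarge L) := by
  have := isLinearTopology_nonInfinitelyLarge hL
  intro a ha
  have hcauchy : CauchySeq fun n => (a n : K) := by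
    rw [cauchySeq_iff]
    intro V hV
    rw [uniformity_eq_comap_nhds_zero] at hV
    obtain ⟨U, hU, hUV⟩ := hV
    have hU' : Subtype.val ⁻¹' U ∈ nhds (0 : nonInfinitelyLarge L) :=
      continuous_subtype_val.continuousAt hU
    obtain ⟨I, hI, hIU⟩ := IsLinearTopology.hasBasis_open_ideal.mem_iff.1 hU'
    obtain ⟨N, hN⟩ := ha I hI
    refine ⟨N, fun k hk l hl => hUV ?_⟩
    have h : a l - a k ∈ I := by
      rw [← sub_sub_sub_cancel_right (a l) (a k) (a N)]
      exact I.sub_mem (hN l hl) (hN k hk)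
    exact hIU h
  obtain ⟨x, hx⟩ := cauchySeq_tendsto_of_complete hcauchy
  have hxA : x ∈ nonInfinitelyLarge L :=
    isClosed_nonInfinitelyLarge.mem_of_tendsto hx (Filter.Eventually.of_forall fun n => (a n).2)
  have hx' : Filter.Tendsto a Filter.atTop (nhds ⟨x, hxA⟩) := tendsto_subtype_rng.2 hx
  refine ⟨⟨x, hxA⟩, fun I hI => ?_⟩
  have h0 : Filter.Tendsto (fun n => a n - ⟨x, hxA⟩) Filter.atTop (nhds 0) :=
    tendsto_sub_nhds_zero_iff.2 hx'
  exact Filter.eventually_atTop.1 (h0 (hI.mem_nhds (zero_mem I)))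

theorem eq_zero_of_forall_mem_isOpen {A : Type*} [CommRing A] [TopologicalSpace A]
    [IsTopologicalRing A] [IsLinearTopology A A] [T1Space A] (x : A)
    (hx : ∀ I : Ideal A, IsOpen (I : Set A) → x ∈ I) : x = 0 := by
  by_contra h
  obtain ⟨I, hI, hIx⟩ :=
    IsLinearTopology.hasBasis_open_ideal.mem_iff.1 (compl_singleton_mem_nhds (Ne.symm h))
  exact hIx (hx I hI) rfl

theorem corollary5p2 {K : Type*} [Field K] [LinearOrder K] [IsStrictOrderedRing K]
    [UniformSpace K] [IsUniformAddGroup K] [OrderTopology K] [CompleteSpace K]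
    (hcount : (nhds (0 : K)).IsCountablyGenerated)
    (hmax : IsMaximalOrdered K)
    (L : Subfield K) (hL : IsNonComparable L) :
    SatisfiesHenselRestricted (nonInfinitelyLarge L) (infinitelySmallIdeal L) := by
  have := isLinearTopology_nonInfinitelyLarge hL
  have := hmax.isRealClosed
  exact .of_liftsCoprimeFactorizations (isSeqCompleteLinear_nonInfinitelyLarge hL)
    eq_zero_of_forall_mem_isOpen infinitelySmallIdeal_le_jacobson_bot
    (isOpen_infinitelySmallIdeal hL) liftsCoprimeFactorizations_infinitelySmallIdeal
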